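/- Let $\mathbb{P}_m$ be the open cone of positive definite Hermitian $m\times m$ complex matrices (inside the real vector space $\mathbb{H}_m$ of Hermitian matrices), and for $A,B\in\mathbb{P}_m$ let $$d(A,B)=\Big[\operatorname{tr}\Big(\tfrac{A+B}{2}\Big)-\operatorname{tr}\big(A^{1/2}BA^{1/2}\big)^{1/2}\Big]^{1/2}$$ be the Wasserstein metric. Let $\omega=(w_1,\dots,w_n)$ be a positive probability vector, i.e. $w_j>0$ for all $j$ and $\sum_{j=1}^n w_j=1$. For $A_1,\dots,A_n\in\mathbb{P}_m$ the Wasserstein mean is $$\Omega(\omega;A_1,\dots,A_n)=\underset{X\in\mathbb{P}_m}{\arg\min}\ \sum_{j=1}^n w_j\,d^2(X,A_j).$$ **Theorem.** The minimizer $\Omega(\omega;A_1,\dots,A_n)\in\mathbb{P}_m$ exists and is unique for all $A_1,\dots,A_n\in\mathbb{P}_m$, and the Wasserstein mean is a multivariate Lie–Trotter mean; that is, the map $\Omega(\omega;\cdot):\mathbb{P}_m^n\to\mathbb{P}_m$ is idempotent ($\Omega(\omega;X,\dots,X)=X$ for all $X\in\mathbb{P}_m$), is differentiable on $\mathbb{P}_m^n$,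 and satisfies $$\lim_{s\to 0}\Omega(\omega;\gamma_1(s),\dots,\gamma_n(s))^{1/s}=\exp\Big[\sum_{j=1}^n w_j\gamma_j'(0)\Big]$$ for every $\epsilon>0$ and all differentiable curves $\gamma_1,\dots,\gamma_n:(-\epsilon,\epsilon)\to\mathbb{P}_m$ with $\gamma_j(0)=I$ for $j=1,\dots,n$. -/

import Mathlib

open scoped ComplexOrder MatrixOrder

/-- `ℙ_m`: the set of positive definite Hermitian `m × m` complex matrices. -/
def posDefMatrices (m : ℕ) : Set (Matrix (Fin m) (Fin m) ℂ) :=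
  {A | A.PosDef}

/-- The Wasserstein metric
`d(A, B) = [tr ((A + B) / 2) - tr (A^{1/2} B A^{1/2})^{1/2}]^{1/2}`
(the traces are real, whence the real parts). -/
noncomputable def wassersteinDist {m : ℕ} (A B : Matrix (Fin m) (Fin m) ℂ) : ℝ :=
  Real.sqrt ((((1 / 2 : ℝ) • (A + B)).trace).re -
    ((CFC.sqrt (CFC.sqrt A * B * CFC.sqrt A)).trace).re)

/-- `X` minimizes `∑ j, w j * d(X, A j) ^ 2` over `ℙ_m`. -/
def IsWassersteinMean {m n : ℕ} (w : Fin n → ℝ) (A : Fin n → Matrix (Fin m) (Fin m) ℂ)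
    (X : Matrix (Fin m) (Fin m) ℂ) : Prop :=
  X ∈ posDefMatrices m ∧
    IsMinOn (fun Y => ∑ j, w j * wassersteinDist Y (A j) ^ 2) (posDefMatrices m) X

/-- The Wasserstein mean `Ω(ω; A_1, …, A_n)`: the minimizer over `ℙ_m` of the weighted sum of
squared Wasserstein distances (an arbitrary matrix if there is no minimizer). -/
noncomputable def wassersteinMean {m n : ℕ} (w : Fin n → ℝ)
    (A : Fin n → Matrix (Fin m) (Fin m) ℂ) : Matrix (Fin m) (Fin m) ℂ :=
  Classical.epsilon (IsWassersteinMean w A)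

/-- A map `G : ℙ_m^n → ℙ_m` (only its values on `ℙ_m^n` matter) is a multivariate Lie-Trotter
mean with weights `w`. -/
structure IsLieTrotterMean {m n : ℕ} (w : Fin n → ℝ)
    (G : (Fin n → Matrix (Fin m) (Fin m) ℂ) → Matrix (Fin m) (Fin m) ℂ) : Prop where
  mapsTo : Set.MapsTo G (Set.univ.pi fun _ => posDefMatrices m) (posDefMatrices m)
  idempotent : ∀ X ∈ posDefMatrices m, G (fun _ => X) = X
  /-- Real differentiability on `ℙ_m^n`, an open subset of the space of tuples of Hermitian
  matrices; derivatives are taken within `ℙ_m^n`, hence along Hermitian directions. -/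
  differentiableOn : DifferentiableOn ℝ G (Set.univ.pi fun _ => posDefMatrices m)
  /-- The power is the real power of the functional calculus. -/
  tendsto : ∀ ε : ℝ, 0 < ε → ∀ γ : Fin n → ℝ → Matrix (Fin m) (Fin m) ℂ,
    (∀ j, Set.MapsTo (γ j) (Set.Ioo (-ε) ε) (posDefMatrices m)) →
    (∀ j, DifferentiableOn ℝ (γ j) (Set.Ioo (-ε) ε)) →
    (∀ j, γ j 0 = 1) →
    Filter.Tendsto (fun s : ℝ => CFC.rpow (G fun j => γ j s) (1 / s))
      (nhdsWithin 0 {0}ᶜ) (nhds (NormedSpace.exp (∑ j, w j • deriv (γ j) 0)))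

/-!
The proof rests on a dual description of the minimization problem. For positive definite `X`, `B`
and `Y`, completing the square gives
`2 tr (X^{1/2} B X^{1/2})^{1/2} ≤ tr (X Y) + tr (B Y⁻¹)`, with equality exactly when `Y X Y = B`
(`trace_add_trace_sub_two_mul_trace_sqrt`). Hence a pair `(X, Y)` with `Y j * X * Y j = A j` and
`∑ j, w j • Y j = 1`, called critical below, certifies that `X` is the unique minimizer: the
objective at `Z` is a constant plus a sum of nonnegative defects, all of which vanish only at
`Z = X` (`IsWassersteinCritical.sum_wassersteinDist_sq`).

A critical pair is found by minimizing `∑ j, w j * tr (A j * (Y j)⁻¹)` over positive definite `Y`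
with `∑ j, w j • Y j = 1`. This problem has compact sublevel sets inside the positive definite
cone (`isCompact_dualSublevel`), and its first order condition says that `(Y j)⁻¹ * A j * (Y j)⁻¹`
is independent of `j` (`exists_isWassersteinCritical`).

Differentiability follows from the inverse function theorem for the polynomial map
`(X, Y) ↦ (∑ j, w j • Y j, (Y j * X * Y j) j)`, whose derivative at a critical pair is injective by
a trace argument (`IsWassersteinCritical.ker_criticalMapDeriv`). Linearizing the critical system at
`X = Y j = 1` shows that the derivative of the mean at `(1, …, 1)` is the weighted arithmetic mean
(`hasDerivAt_wassersteinMean_comp`), and the Lie–Trotter formula follows because the logarithm has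
derivative the identity at `1` (`tendsto_rpow_of_hasDerivAt`).
-/

/-! ### Positive definite matrices -/

section PosDef

variable {k : Type*} [Fintype k] [DecidableEq k]

theorem Matrix.PosDef.sqrt {A : Matrix k k ℂ} (hA : A.PosDef) : (CFC.sqrt A).PosDef := by
  refine (Matrix.nonneg_iff_posSemidef.1 (CFC.sqrt_nonneg A)).posDef_iff_isUnit.2 ?_
  have h : IsUnit (CFC.sqrt A * CFC.sqrt A) := by
    rw [CFC.sqrt_mul_sqrt_self A hA.posSemidef.nonneg]; exact hA.isUnit
  rw [Matrix.isUnit_iff_isUnit_det] at h ⊢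
  rw [Matrix.det_mul] at h
  exact isUnit_of_mul_isUnit_left h

theorem Matrix.PosDef.mul_mul_self {A B : Matrix k k ℂ} (hA : A.PosDef) (hB : B.PosDef) :
    (B * A * B).PosDef := by
  have h := (Matrix.IsUnit.posDef_star_left_conjugate_iff hB.isUnit (x := A)).2 hA
  rwa [Matrix.star_eq_conjTranspose, hB.isHermitian.eq] at h

theorem trace_posDef_form_eq {Z X : Matrix k k ℂ} (hZ : Z.PosDef) (hX : X.PosDef)
    (D : Matrix k k ℂ) :
    (Z * D * X * D.conjTranspose).trace =
      ((CFC.sqrt Z * D * CFC.sqrt X) * (CFC.sqrt Z * D * CFC.sqrt X).conjTranspose).trace := by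
  have hS := CFC.sqrt_mul_sqrt_self Z hZ.posSemidef.nonneg
  have hT := CFC.sqrt_mul_sqrt_self X hX.posSemidef.nonneg
  rw [Matrix.conjTranspose_mul, Matrix.conjTranspose_mul, hZ.sqrt.isHermitian.eq,
    hX.sqrt.isHermitian.eq]
  conv_lhs => rw [← hS, ← hT]
  rw [show CFC.sqrt Z * CFC.sqrt Z * D * (CFC.sqrt X * CFC.sqrt X) * D.conjTranspose =
    CFC.sqrt Z * (CFC.sqrt Z * D * CFC.sqrt X * (CFC.sqrt X * D.conjTranspose)) by
      simp only [mul_assoc], Matrix.trace_mul_comm]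
  simp only [mul_assoc]

theorem re_trace_posDef_form_nonneg {Z X : Matrix k k ℂ} (hZ : Z.PosDef) (hX : X.PosDef)
    (D : Matrix k k ℂ) : 0 ≤ (Z * D * X * D.conjTranspose).trace.re := by
  rw [trace_posDef_form_eq hZ hX]
  exact (Complex.le_def.1 (Matrix.posSemidef_self_mul_conjTranspose _).trace_nonneg).1

/-- Definiteness of the form `D ↦ tr (Z D X Dᴴ)`, the square of the Hilbert–Schmidt norm of
`Z^{1/2} D X^{1/2}`. -/
theorem eq_zero_of_re_trace_posDef_form_eq_zero {Z X : Matrix k k ℂ} (hZ : Z.PosDef)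
    (hX : X.PosDef) {D : Matrix k k ℂ} (h : (Z * D * X * D.conjTranspose).trace.re = 0) :
    D = 0 := by
  rw [trace_posDef_form_eq hZ hX] at h
  have h0 := (Matrix.posSemidef_self_mul_conjTranspose
    (CFC.sqrt Z * D * CFC.sqrt X)).trace_nonneg
  have h1 := Matrix.trace_mul_conjTranspose_self_eq_zero_iff.1
    (Complex.ext h (Complex.le_def.1 h0).2.symm)
  have h2 : CFC.sqrt Z * D = 0 := hX.sqrt.isUnit.mul_left_eq_zero.1 h1
  exact hZ.sqrt.isUnit.mul_right_eq_zero.1 h2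

end PosDef

/-! ### The variational formula for the fidelity -/

section Fidelity

variable {k : Type*} [Fintype k] [DecidableEq k]

/-- Completing the square: with `P = (X^{1/2} B X^{1/2})^{1/2}` and `W = X^{1/2} Y X^{1/2}`, the
quantity `tr (X Y) + tr (B Y⁻¹) - 2 tr P` equals `tr (W⁻¹ (W - P) (W - P))`. -/
theorem trace_add_trace_sub_two_mul_trace_sqrt {X B Y : Matrix k k ℂ} (hX : X.PosDef)
    (hB : B.PosDef) (hY : Y.PosDef) :
    (X * Y).trace + (B * Y⁻¹).trace -
        2 * (CFC.sqrt (CFC.sqrt X * B * CFC.sqrt X)).trace =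
      ((CFC.sqrt X * Y * CFC.sqrt X)⁻¹ *
        (CFC.sqrt X * Y * CFC.sqrt X - CFC.sqrt (CFC.sqrt X * B * CFC.sqrt X)) * 1 *
        (CFC.sqrt X * Y * CFC.sqrt X -
          CFC.sqrt (CFC.sqrt X * B * CFC.sqrt X)).conjTranspose).trace := by
  have hW := (hY.mul_mul_self hX.sqrt)
  have hP := (hB.mul_mul_self hX.sqrt).sqrt
  have hSS := CFC.sqrt_mul_sqrt_self X hX.posSemidef.nonneg
  have hPP := CFC.sqrt_mul_sqrt_self _ (hB.mul_mul_self hX.sqrt).posSemidef.nonneg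
  rw [(hW.isHermitian.sub hP.isHermitian).eq]
  have hWi : (CFC.sqrt X * Y * CFC.sqrt X)⁻¹ = (CFC.sqrt X)⁻¹ * Y⁻¹ * (CFC.sqrt X)⁻¹ := by
    rw [Matrix.mul_inv_rev, Matrix.mul_inv_rev, mul_assoc]
  have hSu := (Matrix.isUnit_iff_isUnit_det _).1 hX.sqrt.isUnit
  have h1 : (CFC.sqrt X * Y * CFC.sqrt X)⁻¹ * (CFC.sqrt X * Y * CFC.sqrt X) = 1 :=
    Matrix.nonsing_inv_mul _ ((Matrix.isUnit_iff_isUnit_det _).1 hW.isUnit)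
  have h2 : (CFC.sqrt X * Y * CFC.sqrt X).trace = (X * Y).trace := by
    rw [Matrix.trace_mul_comm, ← mul_assoc, hSS]
  set P := CFC.sqrt (CFC.sqrt X * B * CFC.sqrt X) with hPdef
  set W := CFC.sqrt X * Y * CFC.sqrt X with hWdef
  have h3 : (W⁻¹ * P * W).trace = P.trace := by
    rw [mul_assoc, Matrix.trace_mul_comm, mul_assoc,
      Matrix.mul_nonsing_inv _ ((Matrix.isUnit_iff_isUnit_det _).1 hW.isUnit), mul_one]
  have h4 : (W⁻¹ * (P * P)).trace = (B * Y⁻¹).trace := by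
    rw [hPP, hWi, show (CFC.sqrt X)⁻¹ * Y⁻¹ * (CFC.sqrt X)⁻¹ * (CFC.sqrt X * B * CFC.sqrt X) =
      (CFC.sqrt X)⁻¹ * (Y⁻¹ * ((CFC.sqrt X)⁻¹ * CFC.sqrt X) * B * CFC.sqrt X) by
        simp only [mul_assoc], Matrix.trace_mul_comm, Matrix.nonsing_inv_mul _ hSu, mul_one,
      mul_assoc, Matrix.mul_nonsing_inv _ hSu, mul_one, Matrix.trace_mul_comm]
  have h5 : W⁻¹ * (W - P) * 1 * (W - P) = W - P - W⁻¹ * P * W + W⁻¹ * (P * P) := by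
    rw [mul_one, mul_sub W⁻¹, h1, sub_mul, one_mul, mul_sub, mul_assoc W⁻¹ P P]
    abel
  rw [h5, Matrix.trace_add, Matrix.trace_sub, Matrix.trace_sub, h2, h3, h4]
  ring

theorem two_mul_re_trace_sqrt_le {X B Y : Matrix k k ℂ} (hX : X.PosDef) (hB : B.PosDef)
    (hY : Y.PosDef) :
    2 * (CFC.sqrt (CFC.sqrt X * B * CFC.sqrt X)).trace.re ≤
      (X * Y).trace.re + (B * Y⁻¹).trace.re := by
  have h := re_trace_posDef_form_nonneg (hY.mul_mul_self hX.sqrt).inv Matrix.PosDef.one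
    (CFC.sqrt X * Y * CFC.sqrt X - CFC.sqrt (CFC.sqrt X * B * CFC.sqrt X))
  rw [← trace_add_trace_sub_two_mul_trace_sqrt hX hB hY] at h
  simp at h
  linarith

theorem mul_mul_eq_of_two_mul_re_trace_sqrt_eq {X B Y : Matrix k k ℂ} (hX : X.PosDef)
    (hB : B.PosDef) (hY : Y.PosDef)
    (h : 2 * (CFC.sqrt (CFC.sqrt X * B * CFC.sqrt X)).trace.re =
      (X * Y).trace.re + (B * Y⁻¹).trace.re) : Y * X * Y = B := by
  have h0 := eq_zero_of_re_trace_posDef_form_eq_zero (hY.mul_mul_self hX.sqrt).inv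
    Matrix.PosDef.one
    (D := CFC.sqrt X * Y * CFC.sqrt X - CFC.sqrt (CFC.sqrt X * B * CFC.sqrt X)) (by
      rw [← trace_add_trace_sub_two_mul_trace_sqrt hX hB hY]
      simp
      linarith)
  have hSS := CFC.sqrt_mul_sqrt_self X hX.posSemidef.nonneg
  have hPP := CFC.sqrt_mul_sqrt_self _ (hB.mul_mul_self hX.sqrt).posSemidef.nonneg
  rw [← sub_eq_zero.1 h0] at hPP
  -- Squaring `W = P` gives `S (Y X Y) S = S B S` with `S = X^{1/2}` invertible.
  have h1 : CFC.sqrt X * (Y * X * Y) * CFC.sqrt X = CFC.sqrt X * B * CFC.sqrt X := by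
    rw [← hPP, show CFC.sqrt X * (Y * X * Y) * CFC.sqrt X =
      CFC.sqrt X * Y * X * Y * CFC.sqrt X by simp only [mul_assoc]]
    nth_rw 2 [← hSS]
    simp only [mul_assoc]
  exact hX.sqrt.isUnit.mul_left_cancel (hX.sqrt.isUnit.mul_right_cancel h1)

theorem trace_sqrt_eq_of_mul_mul_eq {X B Y : Matrix k k ℂ} (hX : X.PosDef) (hY : Y.PosDef)
    (h : Y * X * Y = B) :
    (CFC.sqrt (CFC.sqrt X * B * CFC.sqrt X)).trace = (X * Y).trace := by
  have hSS := CFC.sqrt_mul_sqrt_self X hX.posSemidef.nonneg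
  have h1 : CFC.sqrt (CFC.sqrt X * B * CFC.sqrt X) = CFC.sqrt X * Y * CFC.sqrt X := by
    refine CFC.sqrt_unique ?_ (hY.mul_mul_self hX.sqrt).posSemidef.nonneg
    calc _ = CFC.sqrt X * Y * (CFC.sqrt X * CFC.sqrt X) * Y * CFC.sqrt X := by
          simp only [mul_assoc]
      _ = _ := by rw [hSS, ← h]; simp only [mul_assoc]
  rw [h1, Matrix.trace_mul_comm, ← mul_assoc, hSS]

end Fidelity

/-- The square root in `wassersteinDist` is not truncated: the radicand is nonnegative by the
variational inequality with `Y = 1`. -/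
theorem wassersteinDist_sq {m : ℕ} {X B : Matrix (Fin m) (Fin m) ℂ} (hX : X.PosDef)
    (hB : B.PosDef) :
    wassersteinDist X B ^ 2 = (X.trace.re + B.trace.re) / 2 -
      (CFC.sqrt (CFC.sqrt X * B * CFC.sqrt X)).trace.re := by
  have h := two_mul_re_trace_sqrt_le hX hB Matrix.PosDef.one
  simp only [mul_one, inv_one] at h
  have h1 : (((1 / 2 : ℝ) • (X + B)).trace).re = (X.trace.re + B.trace.re) / 2 := by
    rw [Matrix.trace_smul, Matrix.trace_add, Complex.real_smul, Complex.re_ofReal_mul,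
      Complex.add_re]
    ring
  rw [wassersteinDist, Real.sq_sqrt, h1]
  rw [h1]
  linarith

/-! ### Topology of the positive definite matrices -/

section Topology

open scoped Matrix.Norms.L2Operator Topology

variable {k : Type*} [Fintype k] [DecidableEq k]

/-- A Hermitian matrix close enough to a positive definite one is positive definite: if `Y = S²`,
then `S⁻¹ Y' S⁻¹` is Hermitian at distance less than `1` from the identity. -/
theorem Matrix.PosDef.eventually_posDef {Y : Matrix k k ℂ} (hY : Y.PosDef) :
    ∀ᶠ Y' in 𝓝 Y, Y'.IsHermitian → Y'.PosDef := by
  set S := CFC.sqrt Y with hS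
  have hSu := (Matrix.isUnit_iff_isUnit_det _).1 hY.sqrt.isUnit
  have hSS : S * S = Y := CFC.sqrt_mul_sqrt_self Y hY.posSemidef.nonneg
  have hSi : S⁻¹.PosDef := hY.sqrt.inv
  have h1 : S⁻¹ * Y * S⁻¹ = 1 := by
    rw [← hSS, ← mul_assoc, Matrix.nonsing_inv_mul _ hSu, one_mul,
      Matrix.mul_nonsing_inv _ hSu]
  have hc : ContinuousAt (fun Y' : Matrix k k ℂ => ‖S⁻¹ * Y' * S⁻¹ - 1‖) Y := by fun_prop
  have hev : ∀ᶠ Y' in 𝓝 Y, ‖S⁻¹ * Y' * S⁻¹ - 1‖ < 1 :=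
    hc.eventually_lt continuousAt_const (by simp [h1])
  filter_upwards [hev] with Y' hlt hherm
  set E := S⁻¹ * Y' * S⁻¹ - 1 with hE
  have hEs : IsSelfAdjoint E := by
    have : (S⁻¹ * Y' * S⁻¹).IsHermitian := by
      have := Matrix.isHermitian_mul_mul_conjTranspose S⁻¹ hherm
      rwa [hSi.isHermitian.eq] at this
    exact this.sub Matrix.isHermitian_one
  have hle := hEs.neg_algebraMap_norm_le_self
  have hpd : (S⁻¹ * Y' * S⁻¹).PosDef := by
    have h2 : S⁻¹ * Y' * S⁻¹ = (1 - ‖E‖) • (1 : Matrix k k ℂ) + (E + algebraMap ℝ _ ‖E‖) := by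
      rw [Algebra.algebraMap_eq_smul_one, hE]
      module
    rw [h2]
    refine (Matrix.PosDef.one.smul (sub_pos.2 hlt)).add_posSemidef ?_
    have := sub_nonneg.2 hle
    rw [sub_neg_eq_add] at this
    exact Matrix.nonneg_iff_posSemidef.1 this
  have h3 : Y' = S * (S⁻¹ * Y' * S⁻¹) * S := by
    rw [mul_assoc S⁻¹, ← mul_assoc, ← mul_assoc, Matrix.mul_nonsing_inv _ hSu, one_mul, mul_assoc,
      Matrix.nonsing_inv_mul _ hSu, mul_one]
  rw [h3]
  exact hpd.mul_mul_self hY.sqrt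

theorem isClosed_setOf_posSemidef : IsClosed {A : Matrix k k ℂ | A.PosSemidef} := by
  simpa only [Matrix.nonneg_iff_posSemidef] using
    CStarAlgebra.isClosed_nonneg (A := Matrix k k ℂ)

end Topology

variable {k : Type*} [Fintype k] [DecidableEq k]

theorem Matrix.PosSemidef.norm_apply_le_re_trace {A : Matrix k k ℂ} (hA : A.PosSemidef)
    (i j : k) : ‖A i j‖ ≤ A.trace.re := by
  have hSS := CFC.sqrt_mul_sqrt_self A hA.nonneg
  have hS : (CFC.sqrt A).IsHermitian :=
    (Matrix.nonneg_iff_posSemidef.1 (CFC.sqrt_nonneg A)).isHermitian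
  set S := CFC.sqrt A
  have h : A.trace.re = ∑ a, ∑ b, ‖S a b‖ ^ 2 := by
    have : A.trace = ((∑ a, ∑ b, ‖S a b‖ ^ 2 : ℝ) : ℂ) := by
      rw [← hSS]
      simp only [Matrix.trace, Matrix.diag, Matrix.mul_apply]
      push_cast
      refine Finset.sum_congr rfl fun a _ => Finset.sum_congr rfl fun b _ => ?_
      rw [← hS.apply b a, ← Complex.mul_conj']
      rfl
    rw [this, Complex.ofReal_re]
  have hrow : ∀ a, ∑ b, ‖S a b‖ ^ 2 ≤ A.trace.re := fun a => by
    rw [h]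
    exact Finset.single_le_sum (f := fun a => ∑ b, ‖S a b‖ ^ 2)
      (fun _ _ => by positivity) (Finset.mem_univ a)
  calc ‖A i j‖ = ‖∑ b, S i b * S b j‖ := by rw [← hSS, Matrix.mul_apply]
    _ ≤ ∑ b, ‖S i b‖ * ‖S j b‖ := by
      refine (norm_sum_le _ _).trans (Finset.sum_le_sum fun b _ => ?_)
      rw [norm_mul, ← hS.apply b j, norm_star]
    _ ≤ ∑ b, (‖S i b‖ ^ 2 + ‖S j b‖ ^ 2) / 2 := by
      refine Finset.sum_le_sum fun b _ => ?_
      linarith [two_mul_le_add_sq ‖S i b‖ ‖S j b‖]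
    _ = ((∑ b, ‖S i b‖ ^ 2) + ∑ b, ‖S j b‖ ^ 2) / 2 := by
      rw [← Finset.sum_div, Finset.sum_add_distrib]
    _ ≤ A.trace.re := by linarith [hrow i, hrow j]

theorem isCompact_setOf_posSemidef_re_trace_le (c : ℝ) :
    IsCompact {A : Matrix k k ℂ | A.PosSemidef ∧ A.trace.re ≤ c} := by
  have hK : IsCompact (X := Matrix k k ℂ)
      (Set.univ.pi fun _ => Set.univ.pi fun _ => Metric.closedBall (0 : ℂ) c) :=
    isCompact_univ_pi fun _ => isCompact_univ_pi fun _ => isCompact_closedBall _ _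
  refine hK.of_isClosed_subset (isClosed_setOf_posSemidef.inter ?_) fun A hA i _ j _ => ?_
  · exact isClosed_le (Complex.continuous_re.comp continuous_id.matrix_trace) continuous_const
  · rw [mem_closedBall_zero_iff]
    exact (hA.1.norm_apply_le_re_trace i j).trans hA.2

/-! ### The critical system of the Wasserstein mean -/

/-- `(X, Y)` solves the critical system of the minimization problem: `Y j` is the positive definite
solution of the Riccati equation `Y j * X * Y j = A j`, that is, the geometric mean `X⁻¹ # A j`, and
the vanishing of the gradient at `X` reads `∑ j, w j • Y j = 1`. -/
structure IsWassersteinCritical {m n : ℕ} (w : Fin n → ℝ) (A : Fin n → Matrix (Fin m) (Fin m) ℂ)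
    (X : Matrix (Fin m) (Fin m) ℂ) (Y : Fin n → Matrix (Fin m) (Fin m) ℂ) : Prop where
  posDef : X.PosDef
  posDef_dual : ∀ j, (Y j).PosDef
  mul_mul_eq : ∀ j, Y j * X * Y j = A j
  sum_smul_eq : ∑ j, w j • Y j = 1

namespace IsWassersteinCritical

variable {m n : ℕ} {w : Fin n → ℝ} {A : Fin n → Matrix (Fin m) (Fin m) ℂ}
  {X : Matrix (Fin m) (Fin m) ℂ} {Y : Fin n → Matrix (Fin m) (Fin m) ℂ}

theorem posDef_data (h : IsWassersteinCritical w A X Y) (j : Fin n) : (A j).PosDef :=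
  h.mul_mul_eq j ▸ h.posDef.mul_mul_self (h.posDef_dual j)

theorem sum_mul_re_trace_mul (h : IsWassersteinCritical w A X Y) (Z : Matrix (Fin m) (Fin m) ℂ) :
    ∑ j, w j * (Z * Y j).trace.re = Z.trace.re := by
  have h1 : Z.trace.re = (Z * ∑ j, w j • Y j).trace.re := by rw [h.sum_smul_eq, mul_one]
  rw [h1, Finset.mul_sum, Matrix.trace_sum, Complex.re_sum]
  refine Finset.sum_congr rfl fun j _ => ?_
  rw [mul_smul_comm, Matrix.trace_smul, Complex.real_smul, Complex.re_ofReal_mul]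

/-- The objective is a constant plus the weighted defects in the variational inequalities for the
fidelities of `Z` and `A j`, tested with `Y j`. -/
theorem sum_wassersteinDist_sq (h : IsWassersteinCritical w A X Y) (hw1 : ∑ j, w j = 1)
    {Z : Matrix (Fin m) (Fin m) ℂ} (hZ : Z.PosDef) :
    ∑ j, w j * wassersteinDist Z (A j) ^ 2 =
      (∑ j, w j * (((A j).trace.re - (A j * (Y j)⁻¹).trace.re) / 2)) +
      ∑ j, w j * (((Z * Y j).trace.re + (A j * (Y j)⁻¹).trace.re -
        2 * (CFC.sqrt (CFC.sqrt Z * A j * CFC.sqrt Z)).trace.re) / 2) := by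
  have h1 := h.sum_mul_re_trace_mul Z
  have h2 : ∑ j, w j * Z.trace.re = Z.trace.re := by rw [← Finset.sum_mul, hw1, one_mul]
  have h3 : ∑ j, w j * ((Z.trace.re - (Z * Y j).trace.re) / 2) = 0 := by
    simp only [mul_div_assoc', mul_sub, ← Finset.sum_div, Finset.sum_sub_distrib, h1, h2]
    simp
  rw [← add_zero (∑ j, w j * (((Z * Y j).trace.re + _ - _) / 2)), ← h3,
    ← Finset.sum_add_distrib, ← Finset.sum_add_distrib]
  refine Finset.sum_congr rfl fun j _ => ?_
  rw [wassersteinDist_sq hZ (h.posDef_data j)]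
  ring

theorem defect_nonneg (h : IsWassersteinCritical w A X Y) {Z : Matrix (Fin m) (Fin m) ℂ}
    (hZ : Z.PosDef) (j : Fin n) :
    0 ≤ ((Z * Y j).trace.re + (A j * (Y j)⁻¹).trace.re -
        2 * (CFC.sqrt (CFC.sqrt Z * A j * CFC.sqrt Z)).trace.re) / 2 := by
  linarith [two_mul_re_trace_sqrt_le hZ (h.posDef_data j) (h.posDef_dual j)]

theorem defect_self (h : IsWassersteinCritical w A X Y) (j : Fin n) :
    ((X * Y j).trace.re + (A j * (Y j)⁻¹).trace.re -
        2 * (CFC.sqrt (CFC.sqrt X * A j * CFC.sqrt X)).trace.re) / 2 = 0 := by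
  have h1 : A j * (Y j)⁻¹ = Y j * X := by
    rw [← h.mul_mul_eq j, mul_assoc, Matrix.mul_nonsing_inv _
      ((Matrix.isUnit_iff_isUnit_det _).1 (h.posDef_dual j).isUnit), mul_one]
  rw [trace_sqrt_eq_of_mul_mul_eq h.posDef (h.posDef_dual j) (h.mul_mul_eq j), h1,
    Matrix.trace_mul_comm (Y j)]
  ring

theorem isWassersteinMean (h : IsWassersteinCritical w A X Y) (hw : ∀ j, 0 < w j)
    (hw1 : ∑ j, w j = 1) : IsWassersteinMean w A X := by
  refine ⟨h.posDef, fun Z hZ => ?_⟩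
  simp only [Set.mem_ofPred_eq]
  rw [h.sum_wassersteinDist_sq hw1 h.posDef, h.sum_wassersteinDist_sq hw1 hZ]
  refine add_le_add le_rfl (Finset.sum_le_sum fun j _ => ?_)
  rw [h.defect_self j, mul_zero]
  exact mul_nonneg (hw j).le (h.defect_nonneg hZ j)

theorem eq_of_isWassersteinMean (h : IsWassersteinCritical w A X Y) (hw : ∀ j, 0 < w j)
    (hw1 : ∑ j, w j = 1) {Z : Matrix (Fin m) (Fin m) ℂ} (hZ : IsWassersteinMean w A Z) :
    Z = X := by
  have hle := hZ.2 h.posDef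
  simp only [Set.mem_ofPred_eq] at hle
  rw [h.sum_wassersteinDist_sq hw1 h.posDef, h.sum_wassersteinDist_sq hw1 hZ.1] at hle
  simp only [h.defect_self, mul_zero, Finset.sum_const_zero, add_zero,
    add_le_iff_nonpos_right] at hle
  have hnn : ∀ j ∈ Finset.univ, 0 ≤ w j * (((Z * Y j).trace.re + (A j * (Y j)⁻¹).trace.re -
      2 * (CFC.sqrt (CFC.sqrt Z * A j * CFC.sqrt Z)).trace.re) / 2) := fun j _ =>
    mul_nonneg (hw j).le (h.defect_nonneg hZ.1 j)
  have hzero := (Finset.sum_eq_zero_iff_of_nonneg hnn).1 (le_antisymm hle (Finset.sum_nonneg hnn))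
  obtain ⟨j, -, -⟩ := Finset.exists_ne_zero_of_sum_ne_zero (hw1.trans_ne one_ne_zero)
  have h1 := (mul_eq_zero.1 (hzero j (Finset.mem_univ j))).resolve_left (hw j).ne'
  have h2 := mul_mul_eq_of_two_mul_re_trace_sqrt_eq hZ.1 (h.posDef_data j) (h.posDef_dual j)
    (by linarith)
  rw [← h.mul_mul_eq j] at h2
  exact (h.posDef_dual j).isUnit.mul_left_cancel ((h.posDef_dual j).isUnit.mul_right_cancel h2)

theorem wassersteinMean_eq (h : IsWassersteinCritical w A X Y) (hw : ∀ j, 0 < w j)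
    (hw1 : ∑ j, w j = 1) : wassersteinMean w A = X :=
  h.eq_of_isWassersteinMean hw hw1 (Classical.epsilon_spec ⟨X, h.isWassersteinMean hw hw1⟩)

end IsWassersteinCritical

/-! ### Existence: the dual minimization problem -/

section Existence

open scoped Matrix.Norms.L2Operator Topology

variable {m n : ℕ} {w : Fin n → ℝ} {A : Fin n → Matrix (Fin m) (Fin m) ℂ}

theorem re_trace_mul_nonneg {k : Type*} [Fintype k] [DecidableEq k] {A Z : Matrix k k ℂ}
    (hA : A.PosSemidef) (hZ : Z.PosSemidef) : 0 ≤ (A * Z).trace.re := by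
  have hS : (CFC.sqrt A).IsHermitian :=
    (Matrix.nonneg_iff_posSemidef.1 (CFC.sqrt_nonneg A)).isHermitian
  rw [← CFC.sqrt_mul_sqrt_self A hA.nonneg, mul_assoc, Matrix.trace_mul_comm]
  have := (hZ.mul_mul_conjTranspose_same (CFC.sqrt A)).trace_nonneg
  rw [hS.eq] at this
  exact (Complex.le_def.1 this).1

/-- The pairs `(Y, Y⁻¹)` with `∑ j, w j • Y j = 1` and dual objective at most `c`. Recording the
inverse as a second variable makes this set visibly closed and the dual objective linear. -/
def dualSublevel (w : Fin n → ℝ) (A : Fin n → Matrix (Fin m) (Fin m) ℂ) (c : ℝ) :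
    Set ((Fin n → Matrix (Fin m) (Fin m) ℂ) × (Fin n → Matrix (Fin m) (Fin m) ℂ)) :=
  {p | (∀ j, (p.1 j).PosSemidef) ∧ (∀ j, (p.2 j).PosSemidef) ∧ (∀ j, p.1 j * p.2 j = 1) ∧
    ∑ j, w j • p.1 j = 1 ∧ ∑ j, w j * (A j * p.2 j).trace.re ≤ c}

theorem isClosed_dualSublevel (c : ℝ) : IsClosed (dualSublevel w A c) := by
  simp only [dualSublevel, Set.ofPred_and, Set.ofPred_forall]
  refine (isClosed_iInter fun j => ?_).inter ((isClosed_iInter fun j => ?_).inter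
    ((isClosed_iInter fun j => ?_).inter (IsClosed.inter ?_ ?_)))
  · exact isClosed_setOf_posSemidef.preimage (f := fun p : (Fin n → Matrix (Fin m) (Fin m) ℂ) ×
      (Fin n → Matrix (Fin m) (Fin m) ℂ) => p.1 j) (by fun_prop)
  · exact isClosed_setOf_posSemidef.preimage (f := fun p : (Fin n → Matrix (Fin m) (Fin m) ℂ) ×
      (Fin n → Matrix (Fin m) (Fin m) ℂ) => p.2 j) (by fun_prop)
  · exact isClosed_eq (by fun_prop) continuous_const
  · exact isClosed_eq (by fun_prop) continuous_const
  · refine isClosed_le (continuous_finsetSum _ fun j _ => continuous_const.mul ?_) continuous_const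
    exact Complex.continuous_re.comp (Continuous.matrix_trace (by fun_prop))

theorem isCompact_dualSublevel (hw : ∀ j, 0 < w j) (hA : ∀ j, (A j).PosDef) (c : ℝ) :
    IsCompact (dualSublevel w A c) := by
  have hK1 : IsCompact (Set.univ.pi fun j =>
      {B : Matrix (Fin m) (Fin m) ℂ | B.PosSemidef ∧ B.trace.re ≤ m / w j}) :=
    isCompact_univ_pi fun j => isCompact_setOf_posSemidef_re_trace_le _
  have hK2 : IsCompact (Set.univ.pi fun j =>
      (fun B => (CFC.sqrt (A j))⁻¹ * B * (CFC.sqrt (A j))⁻¹) ''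
        {B : Matrix (Fin m) (Fin m) ℂ | B.PosSemidef ∧ B.trace.re ≤ c / w j}) :=
    isCompact_univ_pi fun j =>
      (isCompact_setOf_posSemidef_re_trace_le _).image (by fun_prop)
  refine (hK1.prod hK2).of_isClosed_subset (isClosed_dualSublevel c) ?_
  rintro ⟨Y, Z⟩ ⟨hY, hZ, -, hsum, hle⟩
  dsimp only at hY hZ hsum hle
  refine ⟨fun j _ => ⟨hY j, ?_⟩, fun j _ => ?_⟩
  · have h1 : ∑ j, w j * (Y j).trace.re = m := by
      have := congrArg (fun B => B.trace.re) hsum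
      simpa [Matrix.trace_sum, Complex.re_sum, Matrix.trace_smul, Matrix.trace_one] using this
    rw [le_div_iff₀' (hw j), ← h1]
    exact Finset.single_le_sum (f := fun j => w j * (Y j).trace.re) (fun i _ =>
      mul_nonneg (hw i).le (Complex.le_def.1 (hY i).trace_nonneg).1) (Finset.mem_univ j)
  · have hSu := (Matrix.isUnit_iff_isUnit_det _).1 (hA j).sqrt.isUnit
    have hSS := CFC.sqrt_mul_sqrt_self (A j) (hA j).posSemidef.nonneg
    refine ⟨CFC.sqrt (A j) * Z j * CFC.sqrt (A j), ⟨?_, ?_⟩, ?_⟩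
    · have := (hZ j).mul_mul_conjTranspose_same (CFC.sqrt (A j))
      rwa [(hA j).sqrt.isHermitian.eq] at this
    · rw [Matrix.trace_mul_comm, ← mul_assoc, hSS, le_div_iff₀' (hw j)]
      refine le_trans ?_ hle
      exact Finset.single_le_sum (f := fun j => w j * (A j * Z j).trace.re) (fun i _ =>
        mul_nonneg (hw i).le (re_trace_mul_nonneg (hA i).posSemidef (hZ i))) (Finset.mem_univ j)
    · dsimp only
      rw [mul_assoc (CFC.sqrt (A j)), ← mul_assoc, ← mul_assoc, Matrix.nonsing_inv_mul _ hSu,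
        one_mul, mul_assoc, Matrix.mul_nonsing_inv _ hSu, mul_one]

theorem exists_dual_minimizer (hw : ∀ j, 0 < w j) (hw1 : ∑ j, w j = 1)
    (hA : ∀ j, (A j).PosDef) :
    ∃ Y : Fin n → Matrix (Fin m) (Fin m) ℂ, (∀ j, (Y j).PosDef) ∧ ∑ j, w j • Y j = 1 ∧
      ∀ Y' : Fin n → Matrix (Fin m) (Fin m) ℂ, (∀ j, (Y' j).PosDef) → ∑ j, w j • Y' j = 1 →
        ∑ j, w j * (A j * (Y j)⁻¹).trace.re ≤ ∑ j, w j * (A j * (Y' j)⁻¹).trace.re := by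
  set c : ℝ := ∑ j, w j * (A j).trace.re with hc
  have hcont : Continuous fun p : (Fin n → Matrix (Fin m) (Fin m) ℂ) ×
      (Fin n → Matrix (Fin m) (Fin m) ℂ) => ∑ j, w j * (A j * p.2 j).trace.re :=
    continuous_finsetSum _ fun j _ => continuous_const.mul
      (Complex.continuous_re.comp (Continuous.matrix_trace (by fun_prop)))
  have hone : ((fun _ => 1, fun _ => 1) : (Fin n → Matrix (Fin m) (Fin m) ℂ) ×
      (Fin n → Matrix (Fin m) (Fin m) ℂ)) ∈ dualSublevel w A c :=
    ⟨fun _ => Matrix.PosSemidef.one, fun _ => Matrix.PosSemidef.one, fun _ => one_mul _,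
      by rw [← Finset.sum_smul, hw1, one_smul], by simp [hc]⟩
  obtain ⟨⟨Y, Z⟩, ⟨hY, hZ, hYZ, hsum, hle⟩, hmin⟩ :=
    (isCompact_dualSublevel hw hA c).exists_isMinOn ⟨_, hone⟩ hcont.continuousOn
  dsimp only at hY hZ hYZ hsum hle
  have hZY : ∀ j, (Y j)⁻¹ = Z j := fun j => Matrix.inv_eq_right_inv (hYZ j)
  refine ⟨Y, fun j => (hY j).posDef_iff_isUnit.2 (IsUnit.of_mul_eq_one _ (hYZ j)), hsum,
    fun Y' hY' hsum' => ?_⟩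
  simp only [hZY]
  by_cases hlt : ∑ j, w j * (A j * (Y' j)⁻¹).trace.re ≤ c
  · exact hmin (a := (Y', fun j => (Y' j)⁻¹)) ⟨fun j => (hY' j).posSemidef,
      fun j => (hY' j).inv.posSemidef, fun j => Matrix.mul_nonsing_inv _
        ((Matrix.isUnit_iff_isUnit_det _).1 (hY' j).isUnit), hsum', hlt⟩
  · exact hle.trans (not_le.1 hlt).le

end Existence

/-! ### Stationarity in the dual problem -/

section RealStructure

open scoped Matrix.Norms.L2Operator

/-- The spectral norm makes the complex matrices a real normed algebra; the scalar action is the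
entrywise one, as opposed to the one obtained by restriction of scalars from `ℂ`. -/
@[reducible]
noncomputable def Matrix.l2OpRealNormedAlgebra {k : Type*} [Fintype k] [DecidableEq k] :
    NormedAlgebra ℝ (Matrix k k ℂ) :=
  { Matrix.instAlgebra with
    norm_smul_le := fun r A => by
      rw [← Complex.coe_smul]
      simpa using norm_smul_le (r : ℂ) A }

/-- The real normed space underlying `Matrix.l2OpRealNormedAlgebra`. -/
@[reducible]
noncomputable def Matrix.l2OpRealNormedSpace {k : Type*} [Fintype k] [DecidableEq k] :
    NormedSpace ℝ (Matrix k k ℂ) :=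
  Matrix.l2OpRealNormedAlgebra.toNormedSpace

end RealStructure

section Stationarity

open scoped Matrix.Norms.L2Operator Topology

attribute [local instance] Matrix.l2OpRealNormedAlgebra Matrix.l2OpRealNormedSpace

variable {m n : ℕ} {w : Fin n → ℝ} {A : Fin n → Matrix (Fin m) (Fin m) ℂ}

theorem hasDerivAt_inv_add_smul {k : Type*} [Fintype k] [DecidableEq k] {Y : Matrix k k ℂ}
    (hY : IsUnit Y) (D : Matrix k k ℂ) :
    HasDerivAt (fun t : ℝ => (Y + t • D)⁻¹) (-(Y⁻¹ * D * Y⁻¹)) 0 := by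
  obtain ⟨u, rfl⟩ := hY
  have h1 : HasDerivAt (fun t : ℝ => (u : Matrix k k ℂ) + t • D) D 0 := by
    simpa using ((hasDerivAt_id (0 : ℝ)).smul_const D).const_add (u : Matrix k k ℂ)
  have h2 := hasFDerivAt_ringInverse (𝕜 := ℝ) u
  have h3 := HasFDerivAt.comp_hasDerivAt_of_eq (0 : ℝ) h2 h1 (by simp)
  simp only [Matrix.nonsing_inv_eq_ringInverse, Ring.inverse_unit]
  simpa [Function.comp_def] using h3

theorem hasDerivAt_re_trace_mul {k : Type*} [Fintype k] [DecidableEq k] (B : Matrix k k ℂ)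
    {f : ℝ → Matrix k k ℂ} {f' : Matrix k k ℂ} {t : ℝ} (hf : HasDerivAt f f' t) :
    HasDerivAt (fun s => (B * f s).trace.re) (B * f').trace.re t := by
  let L : Matrix k k ℂ →ₗ[ℝ] ℝ :=
    Complex.reLm ∘ₗ (Matrix.traceLinearMap k ℝ ℂ) ∘ₗ (LinearMap.mulLeft ℝ B)
  exact (LinearMap.toContinuousLinearMap L).hasFDerivAt.comp_hasDerivAt t hf

/-- The first order condition for the dual problem. -/
theorem sum_mul_re_trace_eq_zero_of_dual_minimizer
    {Y : Fin n → Matrix (Fin m) (Fin m) ℂ}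
    (hY : ∀ j, (Y j).PosDef) (hsum : ∑ j, w j • Y j = 1)
    (hmin : ∀ Y' : Fin n → Matrix (Fin m) (Fin m) ℂ, (∀ j, (Y' j).PosDef) →
      ∑ j, w j • Y' j = 1 →
        ∑ j, w j * (A j * (Y j)⁻¹).trace.re ≤ ∑ j, w j * (A j * (Y' j)⁻¹).trace.re)
    {D : Fin n → Matrix (Fin m) (Fin m) ℂ} (hD : ∀ j, (D j).IsHermitian)
    (hD0 : ∑ j, w j • D j = 0) :
    ∑ j, w j * ((Y j)⁻¹ * A j * (Y j)⁻¹ * D j).trace.re = 0 := by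
  have hder : HasDerivAt (fun t : ℝ => ∑ j, w j * (A j * (Y j + t • D j)⁻¹).trace.re)
      (∑ j, w j * (A j * -((Y j)⁻¹ * D j * (Y j)⁻¹)).trace.re) 0 :=
    HasDerivAt.fun_sum fun j _ =>
      (hasDerivAt_re_trace_mul (A j) (hasDerivAt_inv_add_smul (hY j).isUnit (D j))).const_mul (w j)
  have hpos : ∀ᶠ t : ℝ in 𝓝 0, ∀ j, (Y j + t • D j).PosDef := by
    refine Filter.eventually_all.2 fun j => ?_
    have hc : Filter.Tendsto (fun t : ℝ => Y j + t • D j) (𝓝 0) (𝓝 (Y j)) := by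
      have : Continuous fun t : ℝ => Y j + t • D j := by fun_prop
      simpa using this.tendsto 0
    filter_upwards [hc.eventually (hY j).eventually_posDef] with t ht
    exact ht ((hY j).isHermitian.add ((hD j).smul (IsSelfAdjoint.all t)))
  have hloc : IsLocalMin (fun t : ℝ => ∑ j, w j * (A j * (Y j + t • D j)⁻¹).trace.re) 0 := by
    filter_upwards [hpos] with t ht
    simp only [zero_smul, add_zero]
    refine hmin _ ht ?_
    simp only [smul_add, Finset.sum_add_distrib, hsum, smul_comm _ t, ← Finset.smul_sum, hD0,
      smul_zero, add_zero]
  have h0 := hloc.hasDerivAt_eq_zero hder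
  rw [← neg_eq_zero, ← h0, ← Finset.sum_neg_distrib]
  refine Finset.sum_congr rfl fun j _ => ?_
  have : ((Y j)⁻¹ * A j * (Y j)⁻¹ * D j).trace = (A j * ((Y j)⁻¹ * D j * (Y j)⁻¹)).trace := by
    rw [mul_assoc, mul_assoc, Matrix.trace_mul_comm]
    simp only [mul_assoc]
  rw [this, mul_neg, Matrix.trace_neg, Complex.neg_re, mul_neg]

/-- At a minimizer of the dual problem the matrices `(Y j)⁻¹ * A j * (Y j)⁻¹` do not depend on
`j`; their common value is the Wasserstein mean. -/
theorem exists_isWassersteinCritical (hw : ∀ j, 0 < w j) (hw1 : ∑ j, w j = 1)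
    (hA : ∀ j, (A j).PosDef) : ∃ X Y, IsWassersteinCritical w A X Y := by
  obtain ⟨Y, hY, hsum, hmin⟩ := exists_dual_minimizer hw hw1 hA
  set B : Fin n → Matrix (Fin m) (Fin m) ℂ := fun j => (Y j)⁻¹ * A j * (Y j)⁻¹ with hB
  have hBpos : ∀ j, (B j).PosDef := fun j => (hA j).mul_mul_self (hY j).inv
  set X := ∑ j, w j • B j with hX
  have hXherm : X.IsHermitian := by
    rw [Matrix.IsHermitian, hX, Matrix.conjTranspose_sum]
    exact Finset.sum_congr rfl fun j _ =>
      ((hBpos j).isHermitian.smul (IsSelfAdjoint.all (w j))).eq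
  -- Test the first order condition with the deviations from the weighted average.
  have hDsum : ∑ j, w j • (B j - X) = 0 := by
    simp only [smul_sub, Finset.sum_sub_distrib, ← Finset.sum_smul, hw1, one_smul, ← hX, sub_self]
  have hDherm : ∀ j, (B j - X).IsHermitian := fun j => (hBpos j).isHermitian.sub hXherm
  have h1 := sum_mul_re_trace_eq_zero_of_dual_minimizer hY hsum hmin hDherm hDsum
  have h2 : ∑ j, w j * (X * (B j - X)).trace.re = 0 := by
    have : (X * ∑ j, w j • (B j - X)).trace.re = 0 := by simp [hDsum]
    rw [← this, Finset.mul_sum, Matrix.trace_sum, Complex.re_sum]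
    refine Finset.sum_congr rfl fun j _ => ?_
    rw [mul_smul_comm, Matrix.trace_smul, Complex.real_smul, Complex.re_ofReal_mul]
  have hform : ∀ j, 0 ≤ (1 * (B j - X) * 1 * (B j - X).conjTranspose).trace.re := fun j =>
    re_trace_posDef_form_nonneg Matrix.PosDef.one Matrix.PosDef.one _
  have h3 : ∑ j, w j * (1 * (B j - X) * 1 * (B j - X).conjTranspose).trace.re = 0 := by
    refine Eq.trans ?_ (sub_eq_zero.2 (h1.trans h2.symm))
    rw [← Finset.sum_sub_distrib]
    refine Finset.sum_congr rfl fun j _ => ?_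
    rw [(hDherm j).eq, ← mul_sub, ← Complex.sub_re, ← Matrix.trace_sub, ← sub_mul, one_mul, mul_one]
  have hBX : ∀ j, B j = X := fun j => by
    have := (Finset.sum_eq_zero_iff_of_nonneg fun j _ =>
      mul_nonneg (hw j).le (hform j)).1 h3 j (Finset.mem_univ j)
    exact sub_eq_zero.1 (eq_zero_of_re_trace_posDef_form_eq_zero Matrix.PosDef.one
      Matrix.PosDef.one ((mul_eq_zero.1 this).resolve_left (hw j).ne'))
  obtain ⟨j₀, -, -⟩ := Finset.exists_ne_zero_of_sum_ne_zero (hw1.trans_ne one_ne_zero)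
  refine ⟨X, Y, hBX j₀ ▸ hBpos j₀, hY, fun j => ?_, hsum⟩
  have hu := (Matrix.isUnit_iff_isUnit_det _).1 (hY j).isUnit
  rw [← hBX j, hB]
  dsimp only
  rw [mul_assoc (Y j)⁻¹, ← mul_assoc, Matrix.mul_nonsing_inv _ hu, one_mul, mul_assoc,
    Matrix.nonsing_inv_mul _ hu, mul_one]

end Stationarity

/-! ### Smooth dependence on the data -/

section Smooth

open scoped Matrix.Norms.L2Operator Topology

attribute [local instance] Matrix.l2OpRealNormedAlgebra Matrix.l2OpRealNormedSpace

variable {m n : ℕ} {w : Fin n → ℝ} {A : Fin n → Matrix (Fin m) (Fin m) ℂ}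
  {X : Matrix (Fin m) (Fin m) ℂ} {Y : Fin n → Matrix (Fin m) (Fin m) ℂ}

/-- The polynomial map whose fibre over `(1, A)` describes the critical system with data `A`. It is
considered on all complex matrices, Hermitian or not. -/
noncomputable def criticalMap (w : Fin n → ℝ)
    (p : Matrix (Fin m) (Fin m) ℂ × (Fin n → Matrix (Fin m) (Fin m) ℂ)) :
    Matrix (Fin m) (Fin m) ℂ × (Fin n → Matrix (Fin m) (Fin m) ℂ) :=
  (∑ j, w j • p.2 j, fun j => p.2 j * p.1 * p.2 j)

/-- The derivative of `criticalMap w` at `p`. -/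
noncomputable def criticalMapDeriv (w : Fin n → ℝ)
    (p : Matrix (Fin m) (Fin m) ℂ × (Fin n → Matrix (Fin m) (Fin m) ℂ)) :
    (Matrix (Fin m) (Fin m) ℂ × (Fin n → Matrix (Fin m) (Fin m) ℂ)) →ₗ[ℝ]
      Matrix (Fin m) (Fin m) ℂ × (Fin n → Matrix (Fin m) (Fin m) ℂ) where
  toFun v := (∑ j, w j • v.2 j,
    fun j => v.2 j * p.1 * p.2 j + p.2 j * v.1 * p.2 j + p.2 j * p.1 * v.2 j)
  map_add' u v := by
    ext1
    · simp [Finset.sum_add_distrib]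
    · funext j
      simp only [Prod.snd_add, Prod.fst_add, Pi.add_apply]
      noncomm_ring
  map_smul' r v := by
    ext1
    · simp [Finset.smul_sum, smul_comm r]
    · funext j
      simp [smul_add]

theorem hasStrictFDerivAt_criticalMap (w : Fin n → ℝ)
    (p : Matrix (Fin m) (Fin m) ℂ × (Fin n → Matrix (Fin m) (Fin m) ℂ)) :
    HasStrictFDerivAt (criticalMap w)
      (LinearMap.toContinuousLinearMap (criticalMapDeriv w p)) p := by
  have hfst := (ContinuousLinearMap.fst ℝ (Matrix (Fin m) (Fin m) ℂ)
    (Fin n → Matrix (Fin m) (Fin m) ℂ)).hasStrictFDerivAt (x := p)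
  have hsnd := fun j => ((ContinuousLinearMap.proj (R := ℝ)
    (φ := fun _ : Fin n => Matrix (Fin m) (Fin m) ℂ) j).comp
      (ContinuousLinearMap.snd ℝ (Matrix (Fin m) (Fin m) ℂ)
        (Fin n → Matrix (Fin m) (Fin m) ℂ))).hasStrictFDerivAt (x := p)
  have h1 := HasStrictFDerivAt.fun_sum (u := Finset.univ) fun j _ => (hsnd j).const_smul (w j)
  have h2 := hasStrictFDerivAt_pi.2 fun j => ((hsnd j).mul' hfst).mul' (hsnd j)
  refine (h1.prodMk h2).congr_fderiv ?_
  refine ContinuousLinearMap.ext fun v => Prod.ext ?_ (funext fun j => ?_)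
  · simp [criticalMapDeriv]
  · simp [criticalMapDeriv, mul_assoc]
    abel

/-- The derivative of `criticalMap w` is injective at a critical pair. Multiplying the linearized
Riccati equation `D X Y + Y U Y + Y X D = 0` by `Y⁻¹` on both sides and pairing it with `Dᴴ` gives
`tr (Y⁻¹ D X Dᴴ) + tr (X D Y⁻¹ Dᴴ) = -tr (U Dᴴ)`. The weighted sum of the right hand sides over `j`
vanishes since `∑ j, w j • D j = 0`, so each of the definite forms on the left is zero. -/
theorem IsWassersteinCritical.ker_criticalMapDeriv (h : IsWassersteinCritical w A X Y)
    (hw : ∀ j, 0 < w j) (hw1 : ∑ j, w j = 1) :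
    LinearMap.ker (criticalMapDeriv w (X, Y)) = ⊥ := by
  refine LinearMap.ker_eq_bot'.2 fun v hv => ?_
  obtain ⟨U, D⟩ := v
  have hD : ∑ j, w j • D j = 0 := congrArg Prod.fst hv
  have hR : ∀ j, D j * X * Y j + Y j * U * Y j + Y j * X * D j = 0 := fun j =>
    congrFun (congrArg Prod.snd hv) j
  have hu := fun j => (Matrix.isUnit_iff_isUnit_det _).1 (h.posDef_dual j).isUnit
  have hR' : ∀ j, (Y j)⁻¹ * D j * X + U + X * D j * (Y j)⁻¹ = 0 := fun j => by
    have h1 : (Y j)⁻¹ * (D j * X * Y j + Y j * U * Y j + Y j * X * D j) * (Y j)⁻¹ =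
        (Y j)⁻¹ * D j * X * (Y j * (Y j)⁻¹) + (Y j)⁻¹ * Y j * U * (Y j * (Y j)⁻¹) +
          (Y j)⁻¹ * Y j * X * D j * (Y j)⁻¹ := by
      noncomm_ring
    rw [hR j, Matrix.mul_nonsing_inv _ (hu j), Matrix.nonsing_inv_mul _ (hu j)] at h1
    simpa using h1.symm
  have hZ : ∀ j, ((Y j)⁻¹ * D j * X * (D j).conjTranspose).trace.re +
      (X * D j * (Y j)⁻¹ * (D j).conjTranspose).trace.re =
        -(U * (D j).conjTranspose).trace.re := fun j => by
    have h1 := congrArg (fun B => (B * (D j).conjTranspose).trace.re) (hR' j)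
    simp only [add_mul, Matrix.trace_add, Complex.add_re, zero_mul, Matrix.trace_zero,
      Complex.zero_re] at h1
    linarith
  have hUD : ∑ j, w j * (U * (D j).conjTranspose).trace.re = 0 := by
    have h1 : (U * (∑ j, w j • D j).conjTranspose).trace.re = 0 := by simp [hD]
    rw [← h1, Matrix.conjTranspose_sum, Finset.mul_sum, Matrix.trace_sum, Complex.re_sum]
    refine Finset.sum_congr rfl fun j _ => ?_
    rw [Matrix.conjTranspose_smul, star_trivial, mul_smul_comm, Matrix.trace_smul,
      Complex.real_smul, Complex.re_ofReal_mul]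
  have hn1 := fun j => re_trace_posDef_form_nonneg (h.posDef_dual j).inv h.posDef (D j)
  have hn2 := fun j => re_trace_posDef_form_nonneg h.posDef (h.posDef_dual j).inv (D j)
  have hsum : ∑ j, w j * (((Y j)⁻¹ * D j * X * (D j).conjTranspose).trace.re +
      (X * D j * (Y j)⁻¹ * (D j).conjTranspose).trace.re) = 0 := by
    simp only [hZ, mul_neg, Finset.sum_neg_distrib, hUD, neg_zero]
  have hD0 : ∀ j, D j = 0 := fun j => by
    have h1 := (Finset.sum_eq_zero_iff_of_nonneg fun j _ =>
      mul_nonneg (hw j).le (add_nonneg (hn1 j) (hn2 j))).1 hsum j (Finset.mem_univ j)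
    have h2 := (mul_eq_zero.1 h1).resolve_left (hw j).ne'
    exact eq_zero_of_re_trace_posDef_form_eq_zero (h.posDef_dual j).inv h.posDef
      (le_antisymm (by linarith [hn2 j]) (hn1 j))
  obtain ⟨j₀, -, -⟩ := Finset.exists_ne_zero_of_sum_ne_zero (hw1.trans_ne one_ne_zero)
  have hU : U = 0 := by simpa [hD0 j₀] using hR' j₀
  exact Prod.ext hU (funext hD0)

theorem criticalMap_star (p : Matrix (Fin m) (Fin m) ℂ ×
    (Fin n → Matrix (Fin m) (Fin m) ℂ)) :
    criticalMap w (star p) = star (criticalMap w p) := by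
  refine Prod.ext ?_ (funext fun j => ?_)
  · simp [criticalMap]
  · simp [criticalMap, mul_assoc]

/-- The inverse function theorem for `criticalMap w`: solutions of the critical system extend
differentiably to nearby data. They are Hermitian because `criticalMap w` commutes with the
conjugate transpose and is locally injective, hence positive definite by openness. -/
theorem IsWassersteinCritical.exists_local_solution (h : IsWassersteinCritical w A X Y)
    (hw : ∀ j, 0 < w j) (hw1 : ∑ j, w j = 1) :
    ∃ Φ : (Fin n → Matrix (Fin m) (Fin m) ℂ) →
        Matrix (Fin m) (Fin m) ℂ × (Fin n → Matrix (Fin m) (Fin m) ℂ),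
      DifferentiableAt ℝ Φ A ∧ Φ A = (X, Y) ∧
        ∀ᶠ A' in 𝓝 A, (∀ j, (A' j).IsHermitian) →
          IsWassersteinCritical w A' (Φ A').1 (Φ A').2 := by
  set E := Matrix (Fin m) (Fin m) ℂ × (Fin n → Matrix (Fin m) (Fin m) ℂ)
  let e : E ≃L[ℝ] E := (LinearEquiv.ofInjectiveEndo (criticalMapDeriv w (X, Y))
    (LinearMap.ker_eq_bot.1 (h.ker_criticalMapDeriv hw hw1))).toContinuousLinearEquiv
  have hf : HasStrictFDerivAt (criticalMap w) (e : E →L[ℝ] E) (X, Y) :=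
    (hasStrictFDerivAt_criticalMap w (X, Y)).congr_fderiv (by ext1 <;> rfl)
  have hval : criticalMap w (X, Y) = (1, A) :=
    Prod.ext h.sum_smul_eq (funext h.mul_mul_eq)
  set ψ := hf.localInverse with hψ
  have hψd : HasStrictFDerivAt ψ (e.symm : E →L[ℝ] E) (1, A) := hval ▸ hf.to_localInverse
  have hψA : ψ (1, A) = (X, Y) := hval ▸ hf.localInverse_apply_image
  have hright : ∀ᶠ q in 𝓝 ((1, A) : E), criticalMap w (ψ q) = q :=
    hval ▸ hf.eventually_right_inverse
  have hleft : ∀ᶠ p in 𝓝 ((X, Y) : E), ψ (criticalMap w p) = p := hf.eventually_left_inverse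
  have hι : DifferentiableAt ℝ (fun A' : Fin n → Matrix (Fin m) (Fin m) ℂ => ((1, A') : E)) A := by
    fun_prop
  have hΦ : DifferentiableAt ℝ (fun A' => ψ (1, A')) A :=
    DifferentiableAt.comp A hψd.hasFDerivAt.differentiableAt hι
  have hΦc : Filter.Tendsto (fun A' => ψ (1, A')) (𝓝 A) (𝓝 (X, Y)) := by
    simpa only [ContinuousAt, hψA] using hΦ.continuousAt
  have hstar : star ((X, Y) : E) = (X, Y) :=
    Prod.ext h.posDef.isHermitian (funext fun j => (h.posDef_dual j).isHermitian)
  have hΦc' : Filter.Tendsto (fun A' => star (ψ (1, A'))) (𝓝 A) (𝓝 (X, Y)) := by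
    have : Filter.Tendsto (star : E → E) (𝓝 (X, Y)) (𝓝 (star (X, Y))) :=
      continuous_star.tendsto _
    rw [hstar] at this
    exact this.comp hΦc
  refine ⟨fun A' => ψ (1, A'), hΦ, hψA, ?_⟩
  have hpos : ∀ᶠ p in 𝓝 ((X, Y) : E), (p.1.IsHermitian → p.1.PosDef) ∧
      ∀ j, (p.2 j).IsHermitian → (p.2 j).PosDef := by
    refine Filter.Eventually.and ?_ (Filter.eventually_all.2 fun j => ?_)
    · exact (continuous_fst.tendsto (X, Y)).eventually h.posDef.eventually_posDef
    · have hc : Continuous fun p : Matrix (Fin m) (Fin m) ℂ ×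
          (Fin n → Matrix (Fin m) (Fin m) ℂ) => p.2 j := by fun_prop
      exact (hc.tendsto (X, Y)).eventually (h.posDef_dual j).eventually_posDef
  filter_upwards [hι.continuousAt.eventually hright, hΦc.eventually hpos, hΦc'.eventually hleft]
    with A' h1 h2 h3 hA'
  have hself : star (ψ (1, A')) = ψ (1, A') := by
    have h4 : star ((1, A') : E) = (1, A') :=
      Prod.ext Matrix.isHermitian_one (funext fun j => hA' j)
    rw [← h3, criticalMap_star, h1, h4]
  refine ⟨h2.1 (congrArg Prod.fst hself), fun j => h2.2 j (congrFun (congrArg Prod.snd hself) j),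
    fun j => congrFun (congrArg Prod.snd h1) j, congrArg Prod.fst h1⟩

end Smooth

/-! ### Logarithms and powers near the identity -/

section Power

open scoped Matrix.Norms.L2Operator Topology

attribute [local instance] Matrix.l2OpRealNormedAlgebra Matrix.l2OpRealNormedSpace

variable {k : Type*} [Fintype k] [DecidableEq k]

theorem Matrix.PosDef.rpow_eq_exp_smul_log {A : Matrix k k ℂ} (hA : A.PosDef) (r : ℝ) :
    CFC.rpow A r = NormedSpace.exp (r • CFC.log A) := by
  have hsp : IsStrictlyPositive A := Matrix.isStrictlyPositive_iff_posDef.2 hA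
  have hpos : ∀ x ∈ spectrum ℝ A, 0 < x := fun x hx => hsp.spectrum_pos hx
  have hlog : ContinuousOn Real.log (spectrum ℝ A) :=
    Real.continuousOn_log.mono fun x hx => (hpos x hx).ne'
  have hsa : IsSelfAdjoint A := hA.isHermitian
  rw [show CFC.rpow A r = A ^ r from rfl, CFC.rpow_eq_cfc_real (a := A) hsp.nonneg,
    CFC.log, ← cfc_smul r Real.log A hlog, ← CFC.real_exp_eq_normedSpace_exp (cfc_predicate _ A),
    ← cfc_comp' Real.exp _ A]
  refine cfc_congr fun x hx => ?_
  rw [Real.rpow_def_of_pos (hpos x hx), smul_eq_mul, mul_comm]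

/-- The logarithm has derivative the identity at `1`. It is defined by the functional calculus on
Hermitian matrices only, where it agrees near `1` with the local inverse of the exponential. -/
theorem hasDerivAt_log_of_posDef {g : ℝ → Matrix k k ℂ} {H : Matrix k k ℂ} (hg : HasDerivAt g H 0)
    (hg1 : g 0 = 1) (hpos : ∀ᶠ s in 𝓝 0, (g s).PosDef) :
    HasDerivAt (fun s => CFC.log (g s)) H 0 := by
  have hexp : HasStrictFDerivAt (NormedSpace.exp : Matrix k k ℂ → Matrix k k ℂ)
      ((ContinuousLinearEquiv.refl ℝ (Matrix k k ℂ) : Matrix k k ℂ →L[ℝ] Matrix k k ℂ)) 0 :=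
    hasStrictFDerivAt_exp_zero (𝕂 := ℝ)
  set ψ : Matrix k k ℂ → Matrix k k ℂ := hexp.localInverse
  have hψ : HasStrictFDerivAt ψ
      ((ContinuousLinearEquiv.refl ℝ (Matrix k k ℂ)).symm : Matrix k k ℂ →L[ℝ] Matrix k k ℂ)
      (g 0) := by
    have := hexp.to_localInverse
    rwa [NormedSpace.exp_zero, ← hg1] at this
  have hcomp : HasDerivAt (fun s => ψ (g s)) H 0 := by
    simpa using! hψ.hasFDerivAt.comp_hasDerivAt 0 hg
  have hlog0 : Filter.Tendsto (fun s => CFC.log (g s)) (𝓝 0) (𝓝 0) := by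
    have h1 : Filter.Tendsto g (𝓝 0) (𝓝[{a | IsSelfAdjoint a ∧ IsUnit a}] 1) := by
      refine tendsto_nhdsWithin_iff.2 ⟨hg1 ▸ hg.continuousAt.tendsto, ?_⟩
      filter_upwards [hpos] with s hs using ⟨hs.isHermitian, hs.isUnit⟩
    have h2 := CFC.continuousOn_log (A := Matrix k k ℂ) 1 ⟨IsSelfAdjoint.one _, isUnit_one⟩
    rw [ContinuousWithinAt, CFC.log_one] at h2
    exact h2.comp h1
  refine hcomp.congr_of_eventuallyEq ?_
  filter_upwards [hlog0.eventually hexp.eventually_left_inverse, hpos] with s h1 h2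
  rwa [CFC.exp_log _ (Matrix.isStrictlyPositive_iff_posDef.2 h2), eq_comm] at h1

theorem tendsto_rpow_of_hasDerivAt {g : ℝ → Matrix k k ℂ} {H : Matrix k k ℂ}
    (hg : HasDerivAt g H 0) (hg1 : g 0 = 1) (hpos : ∀ᶠ s in 𝓝 0, (g s).PosDef) :
    Filter.Tendsto (fun s : ℝ => CFC.rpow (g s) (1 / s)) (𝓝[≠] 0) (𝓝 (NormedSpace.exp H)) := by
  have h1 := hasDerivAt_iff_tendsto_slope.1 (hasDerivAt_log_of_posDef hg hg1 hpos)
  have h2 := (NormedSpace.exp_analytic (𝕂 := ℝ) H).continuousAt.tendsto.comp h1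
  refine h2.congr' ?_
  filter_upwards [hpos.filter_mono nhdsWithin_le_nhds] with s hs
  rw [hs.rpow_eq_exp_smul_log, Function.comp_apply, slope_def_module, hg1, CFC.log_one, sub_zero,
    sub_zero, one_div]

end Power

/-! ### The Wasserstein mean as a Lie–Trotter mean -/

section LieTrotter

open scoped Matrix.Norms.L2Operator Topology

attribute [local instance] Matrix.l2OpRealNormedAlgebra Matrix.l2OpRealNormedSpace

variable {m n : ℕ} {w : Fin n → ℝ}

theorem isWassersteinCritical_const (hw1 : ∑ j, w j = 1) {X : Matrix (Fin m) (Fin m) ℂ}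
    (hX : X.PosDef) : IsWassersteinCritical w (fun _ => X) X (fun _ => 1) where
  posDef := hX
  posDef_dual _ := Matrix.PosDef.one
  mul_mul_eq _ := by simp
  sum_smul_eq := by rw [← Finset.sum_smul, hw1, one_smul]

theorem wassersteinMean_posDef (hw : ∀ j, 0 < w j) (hw1 : ∑ j, w j = 1)
    {A : Fin n → Matrix (Fin m) (Fin m) ℂ} (hA : ∀ j, (A j).PosDef) :
    (wassersteinMean w A).PosDef := by
  obtain ⟨X, Y, h⟩ := exists_isWassersteinCritical hw hw1 hA
  rw [h.wassersteinMean_eq hw hw1]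
  exact h.posDef

theorem differentiableWithinAt_wassersteinMean (hw : ∀ j, 0 < w j) (hw1 : ∑ j, w j = 1)
    {A : Fin n → Matrix (Fin m) (Fin m) ℂ} (hA : ∀ j, (A j).PosDef) :
    DifferentiableWithinAt ℝ (wassersteinMean w) (Set.univ.pi fun _ => posDefMatrices m) A := by
  obtain ⟨X, Y, h⟩ := exists_isWassersteinCritical hw hw1 hA
  obtain ⟨Φ, hΦ, hΦA, hev⟩ := h.exists_local_solution hw hw1
  refine hΦ.fst.differentiableWithinAt.congr_of_eventuallyEq ?_ ?_
  · filter_upwards [hev.filter_mono nhdsWithin_le_nhds, self_mem_nhdsWithin] with A' h1 h2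
    exact (h1 fun j => (h2 j trivial).isHermitian).wassersteinMean_eq hw hw1
  · rw [h.wassersteinMean_eq hw hw1, hΦA]

/-- The first order expansion of the mean at `(1, …, 1)`: differentiating `Y j * X * Y j = γ j` and
`∑ j, w j • Y j = 1` at `X = Y j = 1` gives `2 • Y j' + X' = γ j'` and `∑ j, w j • Y j' = 0`. -/
theorem hasDerivAt_wassersteinMean_comp (hw : ∀ j, 0 < w j) (hw1 : ∑ j, w j = 1)
    {γ : Fin n → ℝ → Matrix (Fin m) (Fin m) ℂ} {γ' : Fin n → Matrix (Fin m) (Fin m) ℂ}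
    (hγ : ∀ j, HasDerivAt (γ j) (γ' j) 0) (hγ1 : ∀ j, γ j 0 = 1)
    (hpos : ∀ᶠ s in 𝓝 0, ∀ j, (γ j s).PosDef) :
    HasDerivAt (fun s => wassersteinMean w fun j => γ j s) (∑ j, w j • γ' j) 0 := by
  obtain ⟨Φ, hΦ, hΦA, hev⟩ := (isWassersteinCritical_const (m := m) hw1
    Matrix.PosDef.one).exists_local_solution hw hw1
  have hγpi : HasDerivAt (fun s j => γ j s) γ' 0 := hasDerivAt_pi.2 hγ
  have hγ0 : (fun j => γ j 0) = fun _ => 1 := funext hγ1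
  have hp := HasFDerivAt.comp_hasDerivAt_of_eq (0 : ℝ) hΦ.hasFDerivAt hγpi hγ0.symm
  set p' := fderiv ℝ Φ (fun _ => 1) γ' with hp'
  have hcrit : ∀ᶠ s in 𝓝 0, IsWassersteinCritical w (fun j => γ j s)
      (Φ fun j => γ j s).1 (Φ fun j => γ j s).2 := by
    have hc := hγpi.continuousAt.tendsto
    rw [hγ0] at hc
    filter_upwards [hc.eventually hev, hpos] with s h1 h2 using h1 fun j => (h2 j).isHermitian
  have hmap := HasFDerivAt.comp_hasDerivAt_of_eq (0 : ℝ)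
    (hasStrictFDerivAt_criticalMap w (1, fun _ => 1)).hasFDerivAt hp
      (by rw [Function.comp_apply, hγ0, hΦA])
  have hmap' : HasDerivAt (fun s => ((1, fun j => γ j s) :
      Matrix (Fin m) (Fin m) ℂ × (Fin n → Matrix (Fin m) (Fin m) ℂ))) (0, γ') 0 :=
    (hasDerivAt_const 0 1).prodMk hγpi
  have heq : criticalMapDeriv w (1, fun _ => 1) p' = (0, γ') := by
    refine hmap.unique (hmap'.congr_of_eventuallyEq ?_)
    filter_upwards [hcrit] with s hs using Prod.ext hs.sum_smul_eq (funext hs.mul_mul_eq)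
  have h1 : ∑ j, w j • p'.2 j = 0 := congrArg Prod.fst heq
  have h2 : ∀ j, γ' j = p'.1 + (2 : ℝ) • p'.2 j := fun j => by
    have h3 := congrFun (congrArg Prod.snd heq) j
    simp only [criticalMapDeriv, LinearMap.coe_mk, AddHom.coe_mk, mul_one, one_mul] at h3
    rw [← h3]
    module
  have h3 : ∑ j, w j • γ' j = p'.1 := by
    simp only [h2, smul_add, Finset.sum_add_distrib, smul_comm _ (2 : ℝ), ← Finset.smul_sum, h1,
      smul_zero, add_zero, ← Finset.sum_smul, hw1, one_smul]
  rw [h3]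
  refine HasDerivAt.congr_of_eventuallyEq (f := fun s => (Φ fun j => γ j s).1) ?_ ?_
  · exact hasFDerivAt_fst.comp_hasDerivAt 0 hp
  · filter_upwards [hcrit] with s hs using hs.wassersteinMean_eq hw hw1

theorem isLieTrotterMean_wassersteinMean (hw : ∀ j, 0 < w j) (hw1 : ∑ j, w j = 1) :
    IsLieTrotterMean w (wassersteinMean (m := m) w) where
  mapsTo A hA := wassersteinMean_posDef hw hw1 fun j => hA j trivial
  idempotent X hX := (isWassersteinCritical_const hw1 hX).wassersteinMean_eq hw hw1
  differentiableOn A hA :=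
    differentiableWithinAt_wassersteinMean hw hw1 fun j => hA j trivial
  tendsto ε hε γ hmaps hdiff hγ1 := by
    have hmem : Set.Ioo (-ε) ε ∈ 𝓝 (0 : ℝ) := Ioo_mem_nhds (neg_lt_zero.2 hε) hε
    have hpos : ∀ᶠ s in 𝓝 (0 : ℝ), ∀ j, (γ j s).PosDef := by
      filter_upwards [hmem] with s hs j using hmaps j hs
    have hγ : ∀ j, HasDerivAt (γ j) (deriv (γ j) 0) 0 := fun j =>
      ((hdiff j).differentiableAt hmem).hasDerivAt
    refine tendsto_rpow_of_hasDerivAt (hasDerivAt_wassersteinMean_comp hw hw1 hγ hγ1 hpos) ?_ ?_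
    · simp only [hγ1]
      exact (isWassersteinCritical_const hw1 Matrix.PosDef.one).wassersteinMean_eq hw hw1
    · filter_upwards [hpos] with s hs using wassersteinMean_posDef hw hw1 hs

end LieTrotter

theorem mainTheorem1 (m n : ℕ) (w : Fin n → ℝ) (hw : ∀ j, 0 < w j) (hw1 : ∑ j, w j = 1) :
    (∀ A : Fin n → Matrix (Fin m) (Fin m) ℂ, (∀ j, A j ∈ posDefMatrices m) →
      IsWassersteinMean w A (wassersteinMean w A) ∧
        ∀ X, IsWassersteinMean w A X → X = wassersteinMean w A) ∧
    IsLieTrotterMean w (wassersteinMean (m := m) w) := by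
  refine ⟨fun A hA => ?_, isLieTrotterMean_wassersteinMean hw hw1⟩
  obtain ⟨X, Y, h⟩ := exists_isWassersteinCritical hw hw1 hA
  rw [h.wassersteinMean_eq hw hw1]
  exact ⟨h.isWassersteinMean hw hw1, fun Z hZ => h.eq_of_isWassersteinMean hw hw1 hZ⟩
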